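/- Let $G$ be an abelian group (not necessarily finite), let $A\subseteq G$ be a finite subset, and let $k$ be an integer with $2\leq k\leq |A|-2$. Write $$k\wedge A=\Bigl\{\sum_{a\in B}a : B\subseteq A,\ |B|=k\Bigr\}$$ for the set of sums of $k$ distinct elements of $A$. An elementary $2$-subgroup of $G$ is a finite subgroup in which every non-identity element has order $2$; a $2$-coset is a coset of an elementary $2$-subgroup, and an almost $2$-coset is a set obtained from a $2$-coset by removing a single element. Then $$|k\wedge A|\geq |A|$$ unless $k\in\{2,|A|-2\}$ and $A$ is a $2$-coset. Furthermore, $$|k\wedge A|>|A|$$ unless $A$ is a coset of a subgroup of $G$, or $k\in\{2,|A|-2\}$ and either (i) $A$ is an almost $2$-coset, or (ii) $|A|=4$ and $A$ is the union of two cosets of a subgroup of order $2$. In both assertions the exceptions are genuine: each inequality fails in every one of the cases excluded from it. -/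

import Mathlib

open scoped Pointwise

/-- The set of all sums of `k` distinct elements of `A`: the sums over `k`-element subsets `B ⊆ A`. -/
def kSums {G : Type*} [AddCommGroup G] [DecidableEq G] (k : ℕ) (A : Finset G) : Finset G :=
  (A.powersetCard k).image (fun B => ∑ a ∈ B, a)

/-- `A` is a coset of the subgroup `H`. -/
def IsCosetOf {G : Type*} [AddCommGroup G] (A : Finset G) (H : AddSubgroup G) : Prop :=
  ∃ g : G, (A : Set G) = g +ᵥ (H : Set G)

/-- A finite subgroup all of whose non-identity elements have order `2`. -/
def IsElementaryTwoSubgroup {G : Type*} [AddCommGroup G] (H : AddSubgroup G) : Prop :=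
  (H : Set G).Finite ∧ ∀ h ∈ H, h ≠ 0 → addOrderOf h = 2

/-- A coset of an elementary `2`-subgroup. -/
def IsTwoCoset {G : Type*} [AddCommGroup G] (A : Finset G) : Prop :=
  ∃ H : AddSubgroup G, IsElementaryTwoSubgroup H ∧ IsCosetOf A H

/-- A set obtained from a `2`-coset by removing a single element. -/
def IsAlmostTwoCoset {G : Type*} [AddCommGroup G] [DecidableEq G] (A : Finset G) : Prop :=
  ∃ B : Finset G, IsTwoCoset B ∧ ∃ b ∈ B, A = B.erase b

/-- The union of two cosets of a subgroup of order `2`. -/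
def IsUnionOfTwoCosetsOfOrderTwo {G : Type*} [AddCommGroup G] (A : Finset G) : Prop :=
  ∃ H : AddSubgroup G, Nat.card H = 2 ∧
    ∃ g₁ g₂ : G, (A : Set G) = (g₁ +ᵥ (H : Set G)) ∪ (g₂ +ᵥ (H : Set G))

/-!
Passing from `B` to `A \ B` reflects `kSums k A` onto `kSums (|A| - k) A`, so one may assume
`2 k ≤ |A|`. Write `n = |A|` and `S = kSums k A`.

For `k = 2`, colour the edge `ab` of the complete graph on `A` by `a + b`. The colouring is proper,
so `n - 1 ≤ |S|`. If `|S| = n - 1`, every vertex sees every colour, and following two edges shows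
that all doubles `2a` agree and that `A` is closed under `a - b + c`: it is a `2`-coset
(`isTwoCoset_of_card_kSums_two_lt`). If `|S| = n`, each vertex `a` misses exactly one colour `m a`
(`IsMissingSum`), and one looks at the vertices `a` for which `2a` is a colour. With two or more of
them `A` is a coset, and exactly one is impossible. With none, for `n ≥ 5` all doubles agree, and
adjoining the point `m x - x` to `A` completes it to a `2`-coset. For `n = 4` two of the three
pairs of opposite edges of the complete graph must have equal colours, which makes `A` a union of
two cosets of a subgroup of order two (`of_card_kSums_two_eq`).

For `k ≥ 3`, induct on `k`, removing two elements at a time. For distinct `a`, `b` in `A` let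
`W = kSums (k - 1) (A \ {a, b})`. Both `a + W` and `b + W` lie in `S`, so if always
`n - 1 ≤ |W|` and if `|S| ≤ n`, then translation by any difference of `A` moves at most one point
out of `S`. Counting the pairs in `S × S` by their difference gives `|S| = n` and
`|A - A| ≤ n + 1`; if `|A - A| = n` then `A` is a coset, and if `|A - A| = n + 1` then `A - A` is a
subgroup, and `A` is a coset minus a point (`card_eq_and_of_forall_card_filter`). The latter
is excluded by an exchange argument: a missing sum would force more than half of that subgroup to
consist of doubles, while it contains elements of order two
(`card_lt_card_kSums_of_card_eq_succ`).
If `|W| ≤ n - 2` for some `a`, `b`, the classification already known for `A \ {a, b}` puts this set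
into a coset that cannot contain both `a` and `b`, so that the sums with and without an outside
element are disjoint and together too numerous. The one exception, `k = 3` and `n = 6` with
`A \ {a, b}` a union of two cosets of a subgroup of order two, is treated directly
(`card_kSums_three_of_union`).
-/

/-! ### Cosets, and elementary bounds on sums -/

section

variable {G : Type*} [AddCommGroup G]

theorem exists_isCosetOf_of_forall_sub_add_mem {A : Finset G} (hne : A.Nonempty)
    (h : ∀ a ∈ A, ∀ b ∈ A, ∀ c ∈ A, a - b + c ∈ A) :
    ∃ H : AddSubgroup G, IsCosetOf A H ∧ ∀ d ∈ H, ∃ a ∈ A, ∃ b ∈ A, d = a - b := by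
  obtain ⟨x, hx⟩ := hne
  refine ⟨{ carrier := {d | x + d ∈ A}
            zero_mem' := by simpa using hx
            add_mem' := ?_
            neg_mem' := ?_ }, ⟨x, ?_⟩, ?_⟩
  · intro d e hd he
    have := h _ hd _ hx _ he
    simp only [Set.mem_ofPred_eq]
    convert this using 1
    abel1
  · intro d hd
    have := h _ hx _ hd _ hx
    simp only [Set.mem_ofPred_eq]
    convert this using 1
    abel1
  · ext y
    rw [Set.mem_vadd_set_iff_neg_vadd_mem]
    simp [← SetLike.mem_coe]
  · intro d hd
    exact ⟨x + d, hd, x, hx, by abel1⟩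

theorem IsCosetOf.sub_mem {A : Finset G} {H : AddSubgroup G} (h : IsCosetOf A H) {a b : G}
    (ha : a ∈ A) (hb : b ∈ A) : a - b ∈ H := by
  obtain ⟨g, hg⟩ := h
  rw [← Finset.mem_coe, hg, Set.mem_vadd_set_iff_neg_vadd_mem] at ha hb
  simpa using H.sub_mem ha hb

theorem IsCosetOf.add_mem {A : Finset G} {H : AddSubgroup G} (h : IsCosetOf A H) {a d : G}
    (ha : a ∈ A) (hd : d ∈ H) : a + d ∈ A := by
  obtain ⟨g, hg⟩ := h
  rw [← Finset.mem_coe, hg, Set.mem_vadd_set_iff_neg_vadd_mem] at ha ⊢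
  simpa [add_assoc] using H.add_mem ha hd

theorem IsCosetOf.natCard_eq {A : Finset G} {H : AddSubgroup G} (h : IsCosetOf A H) :
    Nat.card H = A.card := by
  obtain ⟨g, hg⟩ := h
  rw [← Set.ncard_coe_finset, hg, Set.ncard_vadd_set]
  rfl

theorem IsTwoCoset.sub_add_mem {A : Finset G} (h : IsTwoCoset A) {a b c : G}
    (ha : a ∈ A) (hb : b ∈ A) (hc : c ∈ A) : a - b + c ∈ A := by
  obtain ⟨H, -, hH⟩ := h
  simpa [add_comm] using hH.add_mem hc (hH.sub_mem ha hb)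

theorem IsTwoCoset.add_self_eq {A : Finset G} (h : IsTwoCoset A) {a b : G}
    (ha : a ∈ A) (hb : b ∈ A) : a + a = b + b := by
  obtain ⟨H, ⟨-, hE⟩, hH⟩ := h
  by_cases hab : a - b = 0
  · rw [sub_eq_zero.1 hab]
  · have h2 := addOrderOf_nsmul_eq_zero (a - b)
    rw [hE _ (hH.sub_mem ha hb) hab, two_nsmul] at h2
    rw [← sub_eq_zero, ← h2]
    abel1

theorem isTwoCoset_of_forall {A : Finset G} (hne : A.Nonempty)
    (h : ∀ a ∈ A, ∀ b ∈ A, ∀ c ∈ A, a - b + c ∈ A)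
    (h2 : ∀ a ∈ A, ∀ b ∈ A, a + a = b + b) : IsTwoCoset A := by
  obtain ⟨H, hH, hd⟩ := exists_isCosetOf_of_forall_sub_add_mem hne h
  obtain ⟨x, hx⟩ := hne
  refine ⟨H, ⟨?_, ?_⟩, hH⟩
  · refine (A.finite_toSet.image (fun a => a - x)).subset ?_
    intro d hdH
    exact ⟨x + d, hH.add_mem hx hdH, by simp⟩
  · intro d hdH hd0
    obtain ⟨a, ha, b, hb, rfl⟩ := hd d hdH
    refine addOrderOf_eq_prime ?_ hd0
    rw [two_nsmul]
    have := h2 a ha b hb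
    rw [← sub_eq_zero] at this
    rw [← this]
    abel1

variable [DecidableEq G]

theorem mem_kSums {k : ℕ} {A : Finset G} {s : G} :
    s ∈ kSums k A ↔ ∃ B ⊆ A, B.card = k ∧ ∑ a ∈ B, a = s := by
  simp [kSums, Finset.mem_powersetCard, and_assoc]

theorem kSums_mono {k : ℕ} {A B : Finset G} (h : A ⊆ B) : kSums k A ⊆ kSums k B :=
  Finset.image_subset_image (Finset.powersetCard_mono h)

theorem add_mem_kSums_succ {k : ℕ} {A B : Finset G} {a w : G} (hB : B ⊆ A) (ha : a ∈ A)
    (haB : a ∉ B) (hw : w ∈ kSums k B) : a + w ∈ kSums (k + 1) A := by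
  obtain ⟨F, hF, hk, rfl⟩ := mem_kSums.1 hw
  refine mem_kSums.2 ⟨insert a F, ?_, ?_, ?_⟩
  · exact Finset.insert_subset ha (hF.trans hB)
  · rw [Finset.card_insert_of_notMem (fun h => haB (hF h)), hk]
  · rw [Finset.sum_insert (fun h => haB (hF h))]

theorem kSums_one (A : Finset G) : kSums 1 A = A := by
  ext s
  rw [mem_kSums]
  constructor
  · rintro ⟨B, hB, h1, rfl⟩
    obtain ⟨b, rfl⟩ := Finset.card_eq_one.1 h1
    simpa using hB
  · intro hs
    exact ⟨{s}, by simpa using hs, by simp, by simp⟩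

theorem mem_kSums_two {A : Finset G} {s : G} :
    s ∈ kSums 2 A ↔ ∃ a ∈ A, ∃ b ∈ A, a ≠ b ∧ a + b = s := by
  rw [mem_kSums]
  constructor
  · rintro ⟨B, hB, h2, rfl⟩
    obtain ⟨a, b, hab, rfl⟩ := Finset.card_eq_two.1 h2
    exact ⟨a, hB (by simp), b, hB (by simp), hab, by rw [Finset.sum_pair hab]⟩
  · rintro ⟨a, ha, b, hb, hab, rfl⟩
    refine ⟨{a, b}, ?_, Finset.card_pair hab, Finset.sum_pair hab⟩
    intro x hx
    rcases Finset.mem_insert.1 hx with rfl | hx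
    · exact ha
    · rwa [Finset.mem_singleton.1 hx]

theorem add_mem_kSums_two {A : Finset G} {a b : G} (ha : a ∈ A) (hb : b ∈ A) (hab : a ≠ b) :
    a + b ∈ kSums 2 A :=
  mem_kSums_two.2 ⟨a, ha, b, hb, hab, rfl⟩

/-- Complementation `B ↦ A \ B` reflects the `k`-sums onto the `(|A| - k)`-sums. -/
theorem card_kSums_sub {k : ℕ} {A : Finset G} (hk : k ≤ A.card) :
    (kSums (A.card - k) A).card = (kSums k A).card := by
  have key : ∀ j ≤ A.card, (kSums j A).card ≤ (kSums (A.card - j) A).card := by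
    intro j hj
    refine Finset.card_le_card_of_injOn (fun s => (∑ a ∈ A, a) - s) ?_
      (fun x _ y _ h => sub_right_injective h)
    intro s hs
    obtain ⟨B, hB, hc, rfl⟩ := mem_kSums.1 hs
    refine mem_kSums.2 ⟨A \ B, Finset.sdiff_subset, ?_, ?_⟩
    · rw [Finset.card_sdiff_of_subset hB, hc]
    · rw [eq_sub_iff_add_eq, Finset.sum_sdiff hB]
  refine le_antisymm ?_ (key k hk)
  have := key (A.card - k) (Nat.sub_le _ _)
  rwa [Nat.sub_sub_self hk] at this

/-- The sums through a fixed `(k - 1)`-subset of `A` are pairwise distinct. -/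
theorem card_le_card_kSums_add {k : ℕ} {A : Finset G} (hk : k + 1 ≤ A.card) :
    A.card ≤ (kSums (k + 1) A).card + k := by
  obtain ⟨F, hF, hc⟩ := Finset.exists_subset_card_eq (show k ≤ A.card by omega)
  have h1 : (A \ F).card ≤ (kSums (k + 1) A).card := by
    refine Finset.card_le_card_of_injOn (fun a => a + ∑ x ∈ F, x) ?_
      (fun x _ y _ h => add_left_injective _ h)
    intro a ha
    have ha' := Finset.mem_sdiff.1 (Finset.mem_coe.1 ha)
    exact add_mem_kSums_succ hF ha'.1 ha'.2 (mem_kSums.2 ⟨F, subset_rfl, hc, rfl⟩)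
  rw [Finset.card_sdiff_of_subset hF, hc] at h1
  omega

/-- If `B` lies in one coset of `H` and `a` outside it, then the sums that use `a` and those that
do not lie in different cosets of `H`. -/
theorem card_kSums_add_card_kSums_le {k : ℕ} {A B : Finset G} {H : AddSubgroup G} {g a : G}
    (hB : B ⊆ A) (hBH : ∀ b ∈ B, b - g ∈ H) (ha : a ∈ A) (haH : a - g ∉ H) :
    (kSums (k + 1) B).card + (kSums k B).card ≤ (kSums (k + 1) A).card := by
  have hH : ∀ j, ∀ s ∈ kSums j B, s - j • g ∈ H := by
    intro j s hs
    obtain ⟨F, hF, hc, rfl⟩ := mem_kSums.1 hs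
    rw [← hc, ← Finset.sum_const, ← Finset.sum_sub_distrib]
    exact H.sum_mem fun x hx => hBH x (hF hx)
  have haB : a ∉ B := fun h => haH (hBH a h)
  rw [← Finset.card_vadd_finset a (kSums k B), ← Finset.card_union_of_disjoint]
  · refine Finset.card_le_card (Finset.union_subset (kSums_mono hB) ?_)
    intro s hs
    obtain ⟨w, hw, rfl⟩ := Finset.mem_vadd_finset.1 hs
    exact add_mem_kSums_succ hB ha haB hw
  · rw [Finset.disjoint_left]
    intro s hs hs'
    obtain ⟨w, hw, rfl⟩ := Finset.mem_vadd_finset.1 hs'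
    refine haH ?_
    have := H.sub_mem (hH _ _ hs) (hH _ _ hw)
    convert this using 1
    rw [vadd_eq_add, succ_nsmul]
    abel1

theorem IsCosetOf.card_kSums_le {k : ℕ} {A : Finset G} {H : AddSubgroup G} (h : IsCosetOf A H)
    (hne : A.Nonempty) : (kSums k A).card ≤ A.card := by
  obtain ⟨g, hg⟩ := hne
  refine Finset.card_le_card_of_injOn (fun s => g + (s - k • g)) ?_
    (fun x _ y _ hxy => sub_left_injective (add_right_injective _ hxy))
  intro s hs
  obtain ⟨F, hF, hc, rfl⟩ := mem_kSums.1 hs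
  refine h.add_mem hg ?_
  rw [← hc, ← Finset.sum_const, ← Finset.sum_sub_distrib]
  exact H.sum_mem fun x hx => h.sub_mem (hF hx) hg

theorem IsTwoCoset.card_kSums_two_lt {A : Finset G} (h : IsTwoCoset A) (hne : A.Nonempty) :
    (kSums 2 A).card < A.card := by
  obtain ⟨g, hg⟩ := hne
  rw [← Finset.card_erase_add_one hg, Nat.lt_succ_iff]
  refine Finset.card_le_card_of_injOn (fun s => s - g) ?_
    (fun x _ y _ hxy => sub_left_injective hxy)
  intro s hs
  obtain ⟨a, ha, b, hb, hab, rfl⟩ := mem_kSums_two.1 hs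
  refine Finset.mem_coe.2 (Finset.mem_erase.2 ⟨?_, ?_⟩)
  · intro he
    have he' : a + b = g + g := sub_eq_iff_eq_add.1 he
    rw [h.add_self_eq hg ha] at he'
    exact hab (add_left_cancel he').symm
  · change a + b - g ∈ A
    have := h.sub_add_mem ha hg hb
    convert this using 1
    abel1

theorem IsAlmostTwoCoset.card_kSums_two_le {A : Finset G} (h : IsAlmostTwoCoset A) :
    (kSums 2 A).card ≤ A.card := by
  obtain ⟨B, hB, b, hb, rfl⟩ := h
  have h1 := hB.card_kSums_two_lt ⟨b, hb⟩
  have h2 := Finset.card_le_card (kSums_mono (k := 2) (Finset.erase_subset b B))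
  have h3 := Finset.card_erase_add_one hb
  omega

theorem IsUnionOfTwoCosetsOfOrderTwo.exists_shift {A : Finset G}
    (h : IsUnionOfTwoCosetsOfOrderTwo A) :
    ∃ u x y : G, u ≠ 0 ∧ u + u = 0 ∧ A = {x, x + u, y, y + u} := by
  obtain ⟨H, hH, x, y, hA⟩ := h
  have : Nontrivial H := by
    have : Finite H := Nat.finite_of_card_ne_zero (by omega)
    exact Finite.one_lt_card_iff_nontrivial.1 (by omega)
  obtain ⟨⟨u, huH⟩, hu⟩ := exists_ne (0 : H)
  have hu0 : u ≠ 0 := fun h0 => hu (Subtype.ext h0)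
  have hHu : ∀ v, v ∈ H ↔ v = 0 ∨ v = u := by
    have h2 := Nat.card_eq_two_iff' (0 : H) |>.1 hH
    intro v
    constructor
    · intro hv
      by_cases hv0 : v = 0
      · exact Or.inl hv0
      · right
        have := h2.unique (y₁ := ⟨v, hv⟩) (y₂ := ⟨u, huH⟩)
          (fun h => hv0 (congrArg Subtype.val h)) hu
        exact congrArg Subtype.val this
    · rintro (rfl | rfl)
      · exact H.zero_mem
      · exact huH
  refine ⟨u, x, y, hu0, ?_, ?_⟩
  · rcases (hHu (u + u)).1 (H.add_mem huH huH) with h | h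
    · exact h
    · exact absurd (add_eq_left.1 h) hu0
  · ext z
    rw [← Finset.mem_coe, hA]
    simp only [Set.mem_union, Set.mem_vadd_set_iff_neg_vadd_mem, SetLike.mem_coe, hHu, vadd_eq_add,
      neg_add_eq_iff_eq_add, Finset.mem_insert, Finset.mem_singleton]
    constructor
    · rintro ((rfl | rfl) | (rfl | rfl)) <;> simp
    · rintro (rfl | rfl | rfl | rfl) <;> simp

theorem IsUnionOfTwoCosetsOfOrderTwo.card_kSums_two_le {A : Finset G}
    (h : IsUnionOfTwoCosetsOfOrderTwo A) : (kSums 2 A).card ≤ 4 := by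
  obtain ⟨u, x, y, -, hu, rfl⟩ := h.exists_shift
  refine (Finset.card_le_card (t := {x + x + u, y + y + u, x + y, x + y + u}) ?_).trans
    Finset.card_le_four
  intro s hs
  obtain ⟨a, ha, b, hb, hab, rfl⟩ := mem_kSums_two.1 hs
  have e1 : x + u + (y + u) = x + y := by rw [add_add_add_comm, hu, add_zero]
  have e2 : y + u + (x + u) = x + y := by rw [add_add_add_comm, hu, add_zero, add_comm]
  simp only [Finset.mem_insert, Finset.mem_singleton] at ha hb ⊢
  rcases ha with rfl | rfl | rfl | rfl <;> rcases hb with rfl | rfl | rfl | rfl <;>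
    first
    | exact absurd rfl hab
    | (left; abel1)
    | (right; left; abel1)
    | (right; right; left; first | exact e1 | exact e2 | abel1)
    | (right; right; right; abel1)

end

/-! ### Fewer pairwise sums than elements, and sets of four elements -/

section

variable {G : Type*} [AddCommGroup G] [DecidableEq G]

theorem card_le_card_kSums_two_add_one {A : Finset G} (h2 : 2 ≤ A.card) :
    A.card ≤ (kSums 2 A).card + 1 :=
  card_le_card_kSums_add (k := 1) h2

theorem isTwoCoset_of_card_kSums_two_lt {A : Finset G} (h3 : 3 ≤ A.card)
    (hS : (kSums 2 A).card < A.card) : IsTwoCoset A := by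
  -- Every vertex `a` sees every colour, so `2a` is never a colour.
  have hm : ∀ a ∈ A, ∀ s ∈ kSums 2 A, s - a ∈ A ∧ s - a ≠ a := by
    intro a ha
    have hsub : a +ᵥ A.erase a ⊆ kSums 2 A := by
      intro s hs
      obtain ⟨b, hb, rfl⟩ := Finset.mem_vadd_finset.1 hs
      exact add_mem_kSums_two ha (Finset.mem_of_mem_erase hb) (Finset.ne_of_mem_erase hb).symm
    have heq := Finset.eq_of_subset_of_card_le hsub (by
      have := Finset.card_erase_add_one ha
      rw [Finset.card_vadd_finset]; omega)
    intro s hs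
    rw [← heq] at hs
    obtain ⟨b, hb, rfl⟩ := Finset.mem_vadd_finset.1 hs
    rw [vadd_eq_add, add_sub_cancel_left]
    exact ⟨Finset.mem_of_mem_erase hb, Finset.ne_of_mem_erase hb⟩
  have hd : ∀ a ∈ A, ∀ x ∈ A, a + a = x + x := by
    intro a ha x hx
    by_cases hax : a = x
    · rw [hax]
    obtain ⟨b, hb, hbn⟩ : ∃ b ∈ A, b ∉ ({a, x} : Finset G) :=
      Finset.exists_mem_notMem_of_card_lt_card (Finset.card_le_two.trans_lt h3)
    simp only [Finset.mem_insert, Finset.mem_singleton, not_or] at hbn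
    have hc := (hm x hx _ (add_mem_kSums_two ha hb (Ne.symm hbn.1))).1
    have hca : a ≠ a + b - x := fun h => hbn.2 (by
      rw [eq_sub_iff_add_eq] at h; exact (add_left_cancel h).symm)
    have hy := (hm b hb _ (add_mem_kSums_two ha hc hca)).1
    have hy' : a + a - x ∈ A := by convert hy using 1; abel
    by_contra hne
    have hxy : x ≠ a + a - x := fun h => hne (eq_sub_iff_add_eq.1 h).symm
    refine (hm a ha _ (add_mem_kSums_two hx hy' hxy)).2 ?_
    abel
  refine isTwoCoset_of_forall (Finset.card_pos.1 (by omega)) ?_ hd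
  intro a ha b hb c hc
  by_cases hac : a = c
  · rw [← hac, show a - b + a = a + a - b by abel, hd a ha b hb, add_sub_cancel_right]
    exact hb
  · have := (hm b hb _ (add_mem_kSums_two ha hc hac)).1
    convert this using 1
    abel

/-- Four points in which at most one pair of opposite edges has equal sums have at least five
pairwise sums. -/
theorem five_le_card_kSums_two {a b c d : G} (hab : a ≠ b) (hac : a ≠ c) (had : a ≠ d)
    (hbc : b ≠ c) (hbd : b ≠ d) (hcd : c ≠ d) (h1 : a + b ≠ c + d) (h2 : a + c ≠ b + d)
    {A : Finset G} (hA : {a, b, c, d} ⊆ A) : 5 ≤ (kSums 2 A).card := by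
  have ha : a ∈ A := hA (by simp)
  have hb : b ∈ A := hA (by simp)
  have hc : c ∈ A := hA (by simp)
  have hd : d ∈ A := hA (by simp)
  have : ({a + b, a + c, a + d, c + d, b + d} : Finset G).card = 5 := by
    have e1 : a + c ≠ c + d := by rw [add_comm c d]; simpa using had
    have e2 : a + b ≠ b + d := by rw [add_comm b d]; simpa using had
    rw [Finset.card_insert_of_notMem, Finset.card_insert_of_notMem, Finset.card_insert_of_notMem,
      Finset.card_pair] <;>
    simp_all [Ne.symm]
  rw [← this]
  refine Finset.card_le_card ?_
  simp only [Finset.insert_subset_iff, Finset.singleton_subset_iff]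
  exact ⟨add_mem_kSums_two ha hb hab, add_mem_kSums_two ha hc hac, add_mem_kSums_two ha hd had,
    add_mem_kSums_two hc hd hcd, add_mem_kSums_two hb hd hbd⟩

theorem isUnion_of_add_eq {a b c d : G} (hbc : b ≠ c) (h1 : a + b = c + d) (h2 : a + c = b + d)
    {A : Finset G} (hA : A = {a, b, c, d}) : IsUnionOfTwoCosetsOfOrderTwo A := by
  have hu : (b - c) + (b - c) = 0 := by
    have e1 : b = c + d - a := by rw [← h1]; abel
    have e2 : c = b + d - a := by rw [← h2]; abel
    calc (b - c) + (b - c) = b - c + ((c + d - a) - (b + d - a)) := by rw [← e1, ← e2]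
      _ = 0 := by abel
  have hu0 : b - c ≠ 0 := sub_ne_zero.2 hbc
  have ho : addOrderOf (b - c) = 2 := addOrderOf_eq_prime (by rw [two_nsmul, hu]) hu0
  refine ⟨AddSubgroup.zmultiples (b - c), by rw [Nat.card_zmultiples, ho], c, d, ?_⟩
  have hmem : ∀ v, v ∈ AddSubgroup.zmultiples (b - c) ↔ v = 0 ∨ v = b - c := by
    intro v
    constructor
    · rintro ⟨z, rfl⟩
      obtain ⟨m, rfl | rfl⟩ := Int.even_or_odd' z <;> dsimp only
      · left
        rw [mul_comm, mul_zsmul, two_zsmul, hu, smul_zero]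
      · right
        rw [mul_comm, add_zsmul, mul_zsmul, two_zsmul, hu, smul_zero, one_zsmul, zero_add]
    · rintro (rfl | rfl)
      · exact AddSubgroup.zero_mem _
      · exact AddSubgroup.mem_zmultiples _
  have ea : a = d + (b - c) := by rw [eq_sub_of_add_eq h2]; abel
  ext z
  rw [hA]
  simp only [Set.mem_union, Set.mem_vadd_set_iff_neg_vadd_mem, SetLike.mem_coe, hmem, vadd_eq_add,
    neg_add_eq_iff_eq_add, Finset.coe_insert, Finset.coe_singleton,
    Set.mem_insert_iff, Set.mem_singleton_iff, add_zero, add_sub_cancel, ← ea]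
  tauto

theorem isUnion_of_card_kSums_two_le {A : Finset G} (h4 : A.card = 4)
    (hS : (kSums 2 A).card ≤ 4) : IsUnionOfTwoCosetsOfOrderTwo A := by
  obtain ⟨a, b, c, d, hab, hac, had, hbc, hbd, hcd, hA⟩ := Finset.card_eq_four.1 h4
  have hnot : ¬ 5 ≤ (kSums 2 A).card := by omega
  by_cases h1 : a + b = c + d
  · by_cases h2 : a + c = b + d
    · exact isUnion_of_add_eq hbc h1 h2 hA
    · by_cases h3 : a + d = b + c
      · exact isUnion_of_add_eq (a := a) (b := b) (c := d) (d := c) hbd (by rw [h1, add_comm]) h3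
          (by rw [hA]; ext; simp; tauto)
      · refine absurd (five_le_card_kSums_two hac had hab hcd hbc.symm hbd.symm
          (by rw [add_comm d b]; exact h2) (by rw [add_comm c b]; exact h3) ?_) hnot
        rw [hA]; intro z; simp; tauto
  · by_cases h2 : a + c = b + d
    · by_cases h3 : a + d = b + c
      · exact isUnion_of_add_eq (a := a) (b := c) (c := d) (d := b) hcd (by rw [h2, add_comm])
          (by rw [h3, add_comm])
          (by rw [hA]; ext; simp; tauto)
      · refine absurd (five_le_card_kSums_two hab had hac hbd hbc hcd.symm
          (by rw [add_comm d c]; exact h1) h3 ?_) hnot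
        rw [hA]; intro z; simp; tauto
    · exact absurd (five_le_card_kSums_two hab hac had hbc hbd hcd h1 h2 hA.ge) hnot

end

/-! ### As many pairwise sums as elements -/

section

variable {G : Type*} [AddCommGroup G] [DecidableEq G]

/-- `IsMissingSum A m` says that, for each `a ∈ A`, the element `m a` is the only element of
`kSums 2 A` that is not of the form `a + b` with `b ∈ A` and `b ≠ a`. In the edge-colouring of the
complete graph on `A` by sums, `m a` is the only colour absent at the vertex `a`. -/
structure IsMissingSum (A : Finset G) (m : G → G) : Prop where
  mem : ∀ a ∈ A, m a ∈ kSums 2 A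
  notMem : ∀ a ∈ A, ∀ b ∈ A, a ≠ b → a + b ≠ m a
  sub_mem : ∀ a ∈ A, ∀ s ∈ kSums 2 A, s ≠ m a → s - a ∈ A
  sub_ne : ∀ a ∈ A, ∀ s ∈ kSums 2 A, s ≠ m a → s ≠ a + a

theorem exists_isMissingSum {A : Finset G} (h : (kSums 2 A).card = A.card) :
    ∃ m : G → G, IsMissingSum A m := by
  have key : ∀ a ∈ A, ∃ t, kSums 2 A \ (a +ᵥ A.erase a) = {t} := by
    intro a ha
    have hsub : a +ᵥ A.erase a ⊆ kSums 2 A := by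
      intro s hs
      obtain ⟨b, hb, rfl⟩ := Finset.mem_vadd_finset.1 hs
      exact add_mem_kSums_two ha (Finset.mem_of_mem_erase hb) (Finset.ne_of_mem_erase hb).symm
    refine Finset.card_eq_one.1 ?_
    rw [Finset.card_sdiff_of_subset hsub, Finset.card_vadd_finset, h]
    have := Finset.card_erase_add_one ha
    omega
  choose! m hm using key
  have hmem : ∀ a ∈ A, m a ∈ kSums 2 A ∧ m a ∉ a +ᵥ A.erase a := by
    intro a ha
    rw [← Finset.mem_sdiff, hm a ha]
    exact Finset.mem_singleton_self _
  have hsub : ∀ a ∈ A, ∀ s ∈ kSums 2 A, s ≠ m a → s - a ∈ A.erase a := by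
    intro a ha s hs hne
    by_contra hcon
    refine hne (Finset.mem_singleton.1 ?_)
    rw [← hm a ha, Finset.mem_sdiff]
    refine ⟨hs, fun hs' => hcon ?_⟩
    obtain ⟨b, hb, rfl⟩ := Finset.mem_vadd_finset.1 hs'
    rwa [vadd_eq_add, add_sub_cancel_left]
  refine ⟨m, fun a ha => (hmem a ha).1, ?_, ?_, ?_⟩
  · intro a ha b hb hab he
    refine (hmem a ha).2 (Finset.mem_vadd_finset.2 ⟨b, ?_, he⟩)
    exact Finset.mem_erase.2 ⟨hab.symm, hb⟩
  · intro a ha s hs hne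
    exact Finset.mem_of_mem_erase (hsub a ha s hs hne)
  · intro a ha s hs hne he
    refine Finset.ne_of_mem_erase (hsub a ha s hs hne) ?_
    rw [he, add_sub_cancel_right]

namespace IsMissingSum

variable {A : Finset G} {m : G → G}

/-- If `2p` is itself a colour, then it is the one absent at `p`. -/
theorem sub_mem_of_add_self_mem (hm : IsMissingSum A m) {p : G} (hp : p ∈ A)
    (hpp : p + p ∈ kSums 2 A) {s : G} (hs : s ∈ kSums 2 A) : s - p ∈ A := by
  by_cases h : s = m p
  · have : p + p = m p := by
      by_contra hne
      exact hm.sub_ne p hp _ hpp hne rfl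
    rwa [h, ← this, add_sub_cancel_right]
  · exact hm.sub_mem p hp s hs h

theorem add_mem_of_add_self_mem {p : G} (hp : p ∈ A)
    (hpp : p + p ∈ kSums 2 A) {a : G} (ha : a ∈ A) : p + a ∈ kSums 2 A := by
  by_cases h : p = a
  · rwa [← h]
  · exact add_mem_kSums_two hp ha h

/-- If `2p` is a colour for two vertices, it is one for all of them, and then `A` is invariant under
its differences. -/
theorem exists_isCosetOf (hm : IsMissingSum A m) {p q : G} (hp : p ∈ A) (hq : q ∈ A)
    (hpq : p ≠ q) (hpp : p + p ∈ kSums 2 A) (hqq : q + q ∈ kSums 2 A) :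
    ∃ H : AddSubgroup G, IsCosetOf A H := by
  have hall : ∀ a ∈ A, a + a ∈ kSums 2 A := by
    intro a ha
    -- `A` and the set of sums are both invariant under translation by `p - q`.
    have h1 : a + p - q ∈ A := hm.sub_mem_of_add_self_mem hq hqq
      (add_comm p a ▸ add_mem_of_add_self_mem hp hpp ha)
    have h2 : a + (a + p - q) ∈ kSums 2 A := by
      refine add_mem_kSums_two ha h1 fun h => hpq ?_
      rw [eq_sub_iff_add_eq] at h
      exact (add_left_cancel h).symm
    have h3 := add_mem_of_add_self_mem hq hqq (hm.sub_mem_of_add_self_mem hp hpp h2)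
    convert h3 using 1
    abel1
  obtain ⟨H, hH, -⟩ := exists_isCosetOf_of_forall_sub_add_mem ⟨p, hp⟩ (A := A) (by
    intro a ha b hb c hc
    have := hm.sub_mem_of_add_self_mem hb (hall b hb) (add_mem_of_add_self_mem ha (hall a ha) hc)
    convert this using 1
    abel1)
  exact ⟨H, hH⟩

/-- It is impossible that `2p` is a colour for exactly one vertex `p`. -/
theorem exists_ne_add_self_mem (hm : IsMissingSum A m) (h4 : 4 ≤ A.card) {p : G} (hp : p ∈ A)
    (hpp : p + p ∈ kSums 2 A) : ∃ q ∈ A, p ≠ q ∧ q + q ∈ kSums 2 A := by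
  by_contra! hno
  have hcl : ∀ a ∈ A, ∀ b ∈ A, a ≠ b → a + b - p ∈ A := fun a ha b hb hab =>
    hm.sub_mem_of_add_self_mem hp hpp (add_mem_kSums_two ha hb hab)
  have hdbl : ∀ a ∈ A, p ≠ a → a + a - p ∉ A := by
    intro a ha hpa h
    refine hno a ha hpa ?_
    have := add_mem_of_add_self_mem hp hpp h
    rwa [add_sub_cancel] at this
  have hmis : ∀ a ∈ A, ∀ b ∈ A, p ≠ a → p ≠ b → a ≠ b → m b = a + a + b - p := by
    intro a ha b hb hpa hpb hab
    have hc := hcl a ha b hb hab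
    have hac : a ≠ a + b - p := fun h => hpb (by
      rw [eq_sub_iff_add_eq] at h; exact add_left_cancel h)
    by_contra hne
    refine hdbl a ha hpa ?_
    have := hm.sub_mem b hb _ (add_mem_kSums_two ha hc hac)
      (fun h => hne (by rw [← h]; abel1))
    convert this using 1
    abel1
  have hpair : ∀ a ∈ A, ∀ b ∈ A, p ≠ a → p ≠ b → a ≠ b → a + b ≠ p + p →
      a + a + b = p + p + p := by
    intro a ha b hb hpa hpb hab hne
    have hc := hcl a ha b hb hab
    have hpc : p ≠ a + b - p := fun h => hne (eq_sub_iff_add_eq.1 h).symm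
    have hca : a + b - p ≠ a := fun h => hpb (by
      rw [sub_eq_iff_eq_add] at h; exact (add_left_cancel h).symm)
    -- Otherwise the colour absent at `a` is computed from `b` and from `a + b - p`.
    by_contra h3
    have e1 := hmis b hb a ha hpb hpa hab.symm
    have e2 := hmis _ hc a ha hpc hpa hca
    refine hno a ha hpa ?_
    have : a + a = p + p := by
      rw [e1] at e2
      rw [← sub_eq_zero] at e2 ⊢
      rw [← neg_eq_zero, ← e2]
      abel1
    rwa [this]
  have hsum : ∀ a ∈ A, ∀ b ∈ A, p ≠ a → p ≠ b → a ≠ b → a + b = p + p := by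
    intro a ha b hb hpa hpb hab
    by_contra hne
    have e1 := hpair a ha b hb hpa hpb hab hne
    have e2 := hpair b hb a ha hpb hpa hab.symm (by rwa [add_comm])
    rw [← e2, add_right_comm, add_assoc, add_assoc, add_comm b] at e1
    exact hab (by simpa using e1)
  obtain ⟨a, ha, b, hb, c, hc, hab, hac, hbc⟩ := Finset.two_lt_card.1
    (show 2 < (A.erase p).card by have := Finset.card_erase_add_one hp; omega)
  rw [Finset.mem_erase] at ha hb hc
  have e1 := hsum a ha.2 b hb.2 ha.1.symm hb.1.symm hab
  rw [← hsum a ha.2 c hc.2 ha.1.symm hc.1.symm hac] at e1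
  exact hbc (add_left_cancel e1)

/-- Since `a + b ≠ m x`, the element `c = a + b - x` lies in `A`. The colour `a + c` is either present
at `b`, which forces `2a = 2x`, or it is the colour `m b` absent at `b`. -/
theorem add_self_eq_or (hm : IsMissingSum A m) (hno : ∀ a ∈ A, a + a ∉ kSums 2 A) {x a b : G}
    (hx : x ∈ A) (ha : a ∈ A) (hb : b ∈ A) (hab : a ≠ b) (hbx : b ≠ x) (hne : a + b ≠ m x) :
    a + a = x + x ∨ a + a + b = m b + x := by
  have hc := hm.sub_mem x hx _ (add_mem_kSums_two ha hb hab) hne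
  have hac : a ≠ a + b - x := fun h => hbx (by
    rw [eq_sub_iff_add_eq] at h; exact (add_left_cancel h).symm)
  have hs := add_mem_kSums_two ha hc hac
  by_cases hmb : a + (a + b - x) = m b
  · right
    rw [← hmb]
    abel1
  · left
    have h2 := hm.sub_mem b hb _ hs hmb
    by_contra hn
    refine hno a ha ?_
    have := add_mem_kSums_two hx h2 (fun h => hn ?_)
    · convert this using 1
      abel1
    · have h' : x + x = x + (a + (a + b - x) - b) := by rw [← h]
      rw [h']
      abel1

/-- If `2a` is never a colour, all doubles agree: two vertices with distinct doubles would force the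
triples `3y` to be all equal and the doubles all distinct, and then every edge avoiding `x` would
have the same colour. -/
theorem add_self_eq (hm : IsMissingSum A m) (hno : ∀ a ∈ A, a + a ∉ kSums 2 A)
    (h5 : 5 ≤ A.card) {a₀ x₀ : G} (ha₀ : a₀ ∈ A) (hx₀ : x₀ ∈ A) : a₀ + a₀ = x₀ + x₀ := by
  by_contra h₀
  -- Distinct doubles force equal triples.
  have htrip : ∀ a ∈ A, ∀ x ∈ A, a + a ≠ x + x → a + a + a = x + x + x := by
    intro a ha x hx hne
    have hax : a ≠ x := fun h => hne (by rw [h])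
    obtain ⟨b, hb, hbn⟩ : ∃ b ∈ A, b ∉ ({a, x, m x - a, m a - x} : Finset G) :=
      Finset.exists_mem_notMem_of_card_lt_card (Finset.card_le_four.trans_lt h5)
    simp only [Finset.mem_insert, Finset.mem_singleton, not_or, eq_sub_iff_add_eq] at hbn
    obtain ⟨hba, hbx, h1, h2⟩ := hbn
    have e1 := (hm.add_self_eq_or hno hx ha hb (Ne.symm hba) hbx (by rwa [add_comm])).resolve_left hne
    have e2 := (hm.add_self_eq_or hno ha hx hb (Ne.symm hbx) hba (by rwa [add_comm])).resolve_left
      hne.symm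
    rw [← sub_eq_zero] at e1 e2 ⊢
    have : a + a + a - (x + x + x) = (a + a + b - (m b + x)) - (x + x + b - (m b + a)) := by abel1
    rw [this, e1, e2, sub_zero]
  have hcube : ∀ y ∈ A, y + y + y = x₀ + x₀ + x₀ := by
    intro y hy
    by_cases h : y + y = x₀ + x₀
    · rw [← htrip a₀ ha₀ x₀ hx₀ h₀]
      exact htrip y hy a₀ ha₀ (by rw [h]; exact Ne.symm h₀)
    · exact htrip y hy x₀ hx₀ h
  have hinj : ∀ y ∈ A, ∀ z ∈ A, y ≠ z → y + y ≠ z + z := by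
    intro y hy z hz hyz h
    have := (hcube y hy).trans (hcube z hz).symm
    rw [h] at this
    exact hyz (add_left_cancel this)
  -- Hence the colour of any edge avoiding `x` is the one absent at `x`.
  have hcol : ∀ x ∈ A, ∀ a ∈ A, ∀ b ∈ A, a ≠ b → a ≠ x → b ≠ x → a + b = m x := by
    intro x hx a ha b hb hab hax hbx
    by_contra hne
    have hy := hm.sub_mem x hx _ (add_mem_kSums_two ha hb hab) hne
    have hyx := hm.sub_ne x hx _ (add_mem_kSums_two ha hb hab) hne
    set y := a + b - x with hyd
    have hxy : x ≠ y := fun h => hyx (by rw [← eq_sub_iff_add_eq.1 (h.trans hyd)])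
    have hya : a ≠ y := fun h => hbx (by
      rw [hyd, eq_sub_iff_add_eq] at h; exact (add_left_cancel h).symm)
    have hyb : b ≠ y := fun h => hax (by
      rw [hyd, eq_sub_iff_add_eq, add_comm a] at h; exact (add_left_cancel h).symm)
    have hxy' : a + b = y + x := by rw [hyd]; abel1
    have hney : a + b ≠ m y := hxy' ▸ hm.notMem y hy x hx hxy.symm
    have e1 := (hm.add_self_eq_or hno hx ha hb hab hbx hne).resolve_left (hinj a ha x hx hax)
    have e2 := (hm.add_self_eq_or hno hy ha hb hab hyb hney).resolve_left (hinj a ha y hy hya)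
    exact hxy (add_left_cancel (e1.symm.trans e2))
  obtain ⟨a, ha, b, hb, c, hc, hab, hac, hbc⟩ := Finset.two_lt_card.1
    (show 2 < (A.erase x₀).card by have := Finset.card_erase_add_one hx₀; omega)
  rw [Finset.mem_erase] at ha hb hc
  have e1 := hcol x₀ hx₀ a ha.2 b hb.2 hab ha.1 hb.1
  rw [← hcol x₀ hx₀ a ha.2 c hc.2 hac ha.1 hc.1] at e1
  exact hbc (add_left_cancel e1)

/-- When all doubles agree, the missing point of the `2`-coset is `m x - x`, for any `x ∈ A`. -/
theorem isAlmostTwoCoset (hm : IsMissingSum A m) (hno : ∀ a ∈ A, a + a ∉ kSums 2 A)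
    (h2 : ∀ a ∈ A, ∀ b ∈ A, a + a = b + b) {x : G} (hx : x ∈ A) : IsAlmostTwoCoset A := by
  set t := m x - x with ht
  have htx : m x = t + x := by rw [ht, sub_add_cancel]
  have htA : t ∉ A := by
    intro h
    by_cases hxt : x = t
    · refine hno x hx ?_
      have := hm.mem x hx
      rw [htx] at this
      rwa [← hxt] at this
    · exact hm.notMem x hx t h hxt (by rw [htx, add_comm])
  obtain ⟨c, hc, e, he, hce, hcem⟩ := mem_kSums_two.1 (hm.mem x hx)
  have ht2 : t + t = x + x := by
    have h1 : t + t = (c + c) + (e + e) - (x + x) := by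
      rw [ht, ← hcem]; abel1
    rw [h1, h2 c hc x hx, h2 e he x hx, add_sub_cancel_right]
  have hclA : ∀ u ∈ A, ∀ v ∈ A, u ≠ v → u + v - x ∈ insert t A := by
    intro u hu v hv huv
    by_cases h : u + v = m x
    · rw [h]; exact Finset.mem_insert_self _ _
    · exact Finset.mem_insert_of_mem (hm.sub_mem x hx _ (add_mem_kSums_two hu hv huv) h)
  -- Translation by `u - x` cannot fix `A`: it would have to fix the extra point `t`.
  have hmu : ∀ u ∈ A, u ≠ x → m u ≠ m x := by
    intro u hu hux hmm
    have hinv : ∀ w ∈ A, w + u - x ∈ A := by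
      intro w hw
      by_cases hwu : w = u
      · rw [hwu, h2 u hu x hx, add_sub_cancel_right]; exact hx
      · refine hm.sub_mem x hx _ (add_mem_kSums_two hw hu hwu) ?_
        rw [← hmm, add_comm]
        exact hm.notMem u hu w hw (Ne.symm hwu)
    have hcu := hinv c hc
    by_cases hcue : c + u - x = e
    · refine htA ?_
      have : t = u := by
        have h1 : t = (c + c) + u - (x + x) := by rw [ht, ← hcem, ← hcue]; abel1
        rw [h1, h2 c hc x hx, add_sub_cancel_left]
      rwa [this]
    · have h1 : t + u - x ∈ insert t A := by
        have := hclA _ hcu e he hcue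
        convert this using 1
        rw [ht, ← hcem]
        abel1
      rcases Finset.mem_insert.1 h1 with h1 | h1
      · rw [sub_eq_iff_eq_add] at h1
        exact hux (add_left_cancel h1)
      · have h3 := hinv _ h1
        have h4 : t + u - x + u - x = t := by
          have : t + u - x + u - x = t + (u + u) - (x + x) := by abel1
          rw [this, h2 u hu x hx, add_sub_cancel_right]
        rw [h4] at h3
        exact htA h3
  have hcl : ∀ u ∈ insert t A, ∀ v ∈ insert t A, u + v - x ∈ insert t A := by
    have hT : ∀ u ∈ A, u + t - x ∈ insert t A := by
      intro u hu
      by_cases hux : u = x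
      · rw [hux, add_sub_cancel_left]; exact Finset.mem_insert_self _ _
      · have h1 := hm.sub_mem u hu _ (hm.mem x hx) (hmu u hu hux).symm
        have h3 : u + t - x = m x - u := by
          have : u + t - x = m x + u - (x + x) := by rw [ht]; abel1
          rw [this, h2 x hx u hu]
          abel1
        rw [h3]
        exact Finset.mem_insert_of_mem h1
    intro u hu v hv
    rcases Finset.mem_insert.1 hu with rfl | hu' <;> rcases Finset.mem_insert.1 hv with rfl | hv'
    · rw [ht2, add_sub_cancel_right]; exact Finset.mem_insert_of_mem hx
    · rw [add_comm]; exact hT v hv'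
    · exact hT u hu'
    · by_cases huv : u = v
      · rw [huv, h2 v hv' x hx, add_sub_cancel_right]; exact Finset.mem_insert_of_mem hx
      · exact hclA u hu' v hv' huv
  have hdbl : ∀ u ∈ insert t A, u + u = x + x := by
    intro u hu
    rcases Finset.mem_insert.1 hu with rfl | hu
    · exact ht2
    · exact h2 u hu x hx
  refine ⟨insert t A, isTwoCoset_of_forall (Finset.insert_nonempty _ _) ?_ ?_, t,
    Finset.mem_insert_self _ _, (Finset.erase_insert htA).symm⟩
  · intro a ha b hb d hd
    have := hcl _ (hcl a ha b hb) d hd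
    have h1 : a - b + d = a + b - x + d - x := by
      have : a + b - x + d - x = a - b + d + (b + b) - (x + x) := by abel1
      rw [this, hdbl b hb, add_sub_cancel_right]
    rwa [h1]
  · intro a ha b hb
    rw [hdbl a ha, hdbl b hb]

end IsMissingSum

/-- Classification of the sets with as many pairwise sums as elements. -/
theorem of_card_kSums_two_eq {A : Finset G} (h4 : 4 ≤ A.card)
    (h : (kSums 2 A).card = A.card) :
    (∃ H : AddSubgroup G, IsCosetOf A H) ∨ IsAlmostTwoCoset A ∨
      (A.card = 4 ∧ IsUnionOfTwoCosetsOfOrderTwo A) := by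
  rcases h4.eq_or_lt with h4' | h5
  · exact Or.inr (Or.inr ⟨h4'.symm, isUnion_of_card_kSums_two_le h4'.symm (by omega)⟩)
  obtain ⟨m, hm⟩ := exists_isMissingSum h
  by_cases hno : ∀ a ∈ A, a + a ∉ kSums 2 A
  · obtain ⟨x, hx⟩ := Finset.card_pos.1 (show 0 < A.card by omega)
    exact Or.inr (Or.inl (hm.isAlmostTwoCoset hno
      (fun a ha b hb => hm.add_self_eq hno h5 ha hb) hx))
  · push Not at hno
    obtain ⟨p, hp, hpp⟩ := hno
    obtain ⟨q, hq, hpq, hqq⟩ := hm.exists_ne_add_self_mem h4 hp hpp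
    exact Or.inl (hm.exists_isCosetOf hp hq hpq hpp hqq)

end

/-! ### Sets nearly invariant under the differences of `A` -/

section

variable {G : Type*} [AddCommGroup G] [DecidableEq G]

/-- Each pair in `S × S` has only one difference. -/
theorem sum_card_filter_sub_mem_le (S D : Finset G) :
    ∑ d ∈ D, (S.filter (fun s => s - d ∈ S)).card ≤ S.card * S.card := by
  have h := Finset.sum_card_bipartiteAbove_eq_sum_card_bipartiteBelow (s := D) (t := S)
    (fun d s => s - d ∈ S)
  simp only [Finset.bipartiteAbove, Finset.bipartiteBelow] at h
  rw [h, ← smul_eq_mul]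
  refine Finset.sum_le_card_nsmul _ _ _ fun s _ => ?_
  refine Finset.card_le_card_of_injOn (fun d => s - d) ?_
    (fun x _ y _ hxy => sub_right_injective hxy)
  intro d hd
  exact (Finset.mem_filter.1 (Finset.mem_coe.1 hd)).2

/-- The number of points of `S` that leave `S` under translation is subadditive. -/
theorem card_add_card_le_card_filter_sub_add (S : Finset G) (d e : G) :
    (S.filter (fun s => s - d ∈ S)).card + (S.filter (fun s => s - e ∈ S)).card ≤
      (S.filter (fun s => s - (d + e) ∈ S)).card + S.card := by
  set T := (S.filter (fun s => s - d ∈ S)).image (fun s => s - d) with hT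
  set U := S.filter (fun s => s - e ∈ S)
  have hTc : T.card = (S.filter (fun s => s - d ∈ S)).card :=
    Finset.card_image_of_injective _ sub_left_injective
  have hTS : T ⊆ S := by
    intro t ht
    obtain ⟨s, hs, rfl⟩ := Finset.mem_image.1 ht
    exact (Finset.mem_filter.1 hs).2
  have h1 : (T ∪ U).card ≤ S.card :=
    Finset.card_le_card (Finset.union_subset hTS (Finset.filter_subset _ _))
  have h2 : (T ∩ U).card ≤ (S.filter (fun s => s - (d + e) ∈ S)).card := by
    refine Finset.card_le_card_of_injOn (fun u => u + d) ?_
      (fun x _ y _ hxy => add_left_injective _ hxy)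
    intro u hu
    obtain ⟨hu1, hu2⟩ := Finset.mem_inter.1 (Finset.mem_coe.1 hu)
    obtain ⟨s, hs, rfl⟩ := Finset.mem_image.1 hu1
    refine Finset.mem_coe.2 (Finset.mem_filter.2 ⟨?_, ?_⟩)
    · simpa using (Finset.mem_filter.1 hs).1
    · change s - d + d - (d + e) ∈ S
      have := (Finset.mem_filter.1 hu2).2
      convert this using 1
      abel1
  have h3 := Finset.card_union_add_card_inter T U
  omega

/-- A finite set `S`, at most as large as `A`, that every difference of two elements of `A` moves
in at most one point. Counting the pairs in `S × S` by their difference gives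
`|A - A| ≤ |A| + 1`, and in the extreme case `A - A` is a subgroup. -/
theorem card_eq_and_of_forall_card_filter {A S : Finset G} (h3 : 3 ≤ A.card)
    (hS : S.card ≤ A.card)
    (h : ∀ a ∈ A, ∀ b ∈ A, a ≠ b → A.card ≤ (S.filter (fun s => s - (a - b) ∈ S)).card + 1) :
    S.card = A.card ∧ ((∃ H : AddSubgroup G, IsCosetOf A H) ∨
      ∃ H : AddSubgroup G, ∃ x : G, Nat.card H = A.card + 1 ∧ ∀ a ∈ A, a - x ∈ H) := by
  obtain ⟨x, hx⟩ := Finset.card_pos.1 (show 0 < A.card by omega)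
  have hSn : S.card = A.card := by
    by_contra hne
    have hinv : ∀ a ∈ A, ∀ b ∈ A, a ≠ b → ∀ s ∈ S, s - (a - b) ∈ S := by
      intro a ha b hb hab
      have := Finset.filter_eq_self.1 (Finset.eq_of_subset_of_card_le
        (Finset.filter_subset (fun s => s - (a - b) ∈ S) S) (by have := h a ha b hb hab; omega))
      exact this
    obtain ⟨y, hy, hyx⟩ : ∃ y ∈ A, y ≠ x := Finset.exists_mem_ne (by omega) x
    have hSne : S.Nonempty := by
      have h1 := h y hy x hx hyx
      have h2 := Finset.card_le_card (Finset.filter_subset (fun s => s - (y - x) ∈ S) S)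
      exact Finset.card_pos.1 (by omega)
    obtain ⟨s, hs⟩ := hSne
    have : A.card ≤ S.card := by
      refine Finset.card_le_card_of_injOn (fun a => s - (a - x)) ?_
        (fun u _ v _ huv => sub_left_injective (sub_right_injective huv))
      intro a ha
      by_cases hax : a = x
      · simpa [hax] using hs
      · exact hinv a ha x hx hax s hs
    omega
  refine ⟨hSn, ?_⟩
  set N : G → ℕ := fun d => (S.filter (fun s => s - d ∈ S)).card with hN
  have hN0 : N 0 = A.card := by
    rw [hN, ← hSn]
    simp
  have hND : ∀ d ∈ A - A, A.card ≤ N d + 1 := by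
    intro d hd
    obtain ⟨a, ha, b, hb, rfl⟩ := Finset.mem_sub.1 hd
    by_cases hab : a = b
    · rw [hab, sub_self, hN0]
      omega
    · exact h a ha b hb hab
  have h0D : (0 : G) ∈ A - A := Finset.mem_sub.2 ⟨x, hx, x, hx, sub_self x⟩
  have hsum : A.card + ((A - A).card - 1) * (A.card - 1) ≤ ∑ d ∈ A - A, N d := by
    rw [← Finset.add_sum_erase _ _ h0D, hN0, ← Finset.card_erase_of_mem h0D, ← smul_eq_mul]
    refine Nat.add_le_add_left (Finset.card_nsmul_le_sum _ _ _ fun d hd => ?_) _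
    have := hND d (Finset.mem_of_mem_erase hd)
    omega
  have htrans : ∀ b ∈ A, A.image (fun a => a - b) ⊆ A - A := by
    intro b hb d hd
    obtain ⟨a, ha, rfl⟩ := Finset.mem_image.1 hd
    exact Finset.sub_mem_sub ha hb
  have hcard : ∀ b, (A.image (fun a => a - b)).card = A.card := fun b =>
    Finset.card_image_of_injective _ sub_left_injective
  have hDn : A.card ≤ (A - A).card := by
    rw [← hcard x]
    exact Finset.card_le_card (htrans x hx)
  have hDsum := sum_card_filter_sub_mem_le S (A - A)
  rcases hDn.eq_or_lt with hDeq | hDlt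
  · left
    obtain ⟨H, hH, -⟩ := exists_isCosetOf_of_forall_sub_add_mem ⟨x, hx⟩ (A := A) (by
      intro a ha b hb c hc
      have heq := Finset.eq_of_subset_of_card_le (htrans c hc) (by rw [hcard, hDeq])
      have hab := Finset.sub_mem_sub ha hb
      rw [← heq] at hab
      obtain ⟨e, he, hec⟩ := Finset.mem_image.1 hab
      rwa [← hec, sub_add_cancel])
    exact ⟨H, hH⟩
  · right
    obtain ⟨n, hn⟩ : ∃ n, A.card = n + 2 := ⟨A.card - 2, by omega⟩
    have hDc : (A - A).card = A.card + 1 := by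
      by_contra hne
      obtain ⟨m, hm⟩ : ∃ m, (A - A).card = n + 4 + m := ⟨(A - A).card - n - 4, by omega⟩
      have := hsum.trans hDsum
      rw [hSn, hm, hn, show n + 4 + m - 1 = n + 3 + m by omega,
        show n + 2 - 1 = n + 1 by omega] at this
      nlinarith
    have hadd : ∀ d ∈ A - A, ∀ e ∈ A - A, d + e ∈ A - A := by
      intro d hd e he
      by_contra hde
      -- The differences in `A - A` already account for all pairs in `S × S`, while `d + e`, as the
      -- sum of two of them, would occur at least `|A| - 2` times as a difference.
      have h1 := card_add_card_le_card_filter_sub_add S d e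
      have h2 := sum_card_filter_sub_mem_le S (insert (d + e) (A - A))
      rw [Finset.sum_insert hde] at h2
      have h4 : A.card ≤ N (d + e) + 2 := by
        have := hND d hd
        have := hND e he
        simp only [hN] at *
        omega
      have h5 : n ≤ N (d + e) := by omega
      have h6 := hsum
      rw [hDc, hn, show n + 2 + 1 - 1 = n + 2 by omega, show n + 2 - 1 = n + 1 by omega] at h6
      rw [hSn, hn] at h2
      have h7 : N (d + e) + ∑ d ∈ A - A, N d ≤ (n + 2) * (n + 2) := h2
      nlinarith
    refine ⟨{ carrier := ((A - A : Finset G) : Set G)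
              zero_mem' := h0D
              add_mem' := fun {d e} hd he => hadd d hd e he
              neg_mem' := ?_ }, x, ?_, ?_⟩
    · intro d hd
      obtain ⟨a, ha, b, hb, rfl⟩ := Finset.mem_sub.1 (Finset.mem_coe.1 hd)
      rw [neg_sub]
      exact Finset.mem_coe.2 (Finset.sub_mem_sub hb ha)
    · rw [← hDc]
      exact (Nat.card_coe_set_eq _).trans (Set.ncard_coe_finset (A - A))
    · intro a ha
      exact Finset.sub_mem_sub ha hx

end

/-! ### From sums of `k` elements to sums of `k + 1` elements -/

section

variable {G : Type*} [AddCommGroup G] [DecidableEq G]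

theorem exists_finset_coset (H : AddSubgroup G) (hH : Nat.card H ≠ 0) (x : G) :
    ∃ C : Finset G, (∀ a, a ∈ C ↔ a - x ∈ H) ∧ C.card = Nat.card H := by
  have hfin : Finite H := Nat.finite_of_card_ne_zero hH
  have hfin' : (H : Set G).Finite := hfin
  refine ⟨x +ᵥ hfin'.toFinset, fun a => ?_, ?_⟩
  · rw [← Finset.mem_coe, Finset.coe_vadd_finset, Set.mem_vadd_set_iff_neg_vadd_mem]
    simp [sub_eq_neg_add]
  · rw [Finset.card_vadd_finset, ← Set.ncard_eq_toFinset_card _ hfin']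
    rfl

/-- If `H` contains an element `u` of order two, doubling is at least two-to-one on `H`, so at most
half of the elements of `H` are doubles. -/
theorem two_mul_card_le_of_subset_double {H : AddSubgroup G} (hH : Nat.card H ≠ 0) {u y : G}
    (hu : u ∈ H) (hu0 : u ≠ 0) (huu : u + u = 0) {X : Finset G}
    (hX : ∀ z ∈ X, ∃ v ∈ H, z - y = v + v) : 2 * X.card ≤ Nat.card H := by
  obtain ⟨C, hC, hCc⟩ := exists_finset_coset H hH 0
  simp only [sub_zero] at hC
  have h1 : X.card ≤ (C.image (fun v => v + v)).card := by
    refine Finset.card_le_card_of_injOn (fun z => z - y) ?_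
      (fun x _ y _ hxy => sub_left_injective hxy)
    intro z hz
    obtain ⟨v, hv, hzv⟩ := hX z hz
    exact Finset.mem_coe.2 (Finset.mem_image.2 ⟨v, (hC v).2 hv, hzv.symm⟩)
  have h2 := Finset.mul_card_image_le_card (f := fun v : G => v + v) C 2 (by
    intro w hw
    obtain ⟨v, hv, rfl⟩ := Finset.mem_image.1 hw
    have hne : v ≠ v + u := by simpa using hu0
    rw [← Finset.card_pair hne]
    refine Finset.card_le_card ?_
    intro z hz
    rw [Finset.mem_filter]
    rcases Finset.mem_insert.1 hz with rfl | hz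
    · exact ⟨hv, rfl⟩
    · rw [Finset.mem_singleton.1 hz]
      exact ⟨(hC _).2 (H.add_mem ((hC _).1 hv) hu), by rw [add_add_add_comm, huu, add_zero]⟩)
  omega

/-- A coset with one point `p` removed has more than `|A|` sums of `k` elements, for `k` away from
the two ends. -/
theorem card_lt_card_kSums_of_card_eq_succ {A : Finset G} {k : ℕ} (hk : 3 ≤ k)
    (hkA : 2 * k ≤ A.card) {H : AddSubgroup G} {x : G} (hHc : Nat.card H = A.card + 1)
    (hAH : ∀ a ∈ A, a - x ∈ H) : A.card < (kSums k A).card := by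
  by_contra! hle
  have hH0 : Nat.card H ≠ 0 := by omega
  obtain ⟨C, hC, hCc⟩ := exists_finset_coset H hH0 x
  have hAC : A ⊆ C := fun a ha => (hC a).2 (hAH a ha)
  obtain ⟨p, hp⟩ := Finset.card_eq_one.1 (show (C \ A).card = 1 by
    rw [Finset.card_sdiff_of_subset hAC]; omega)
  have hCp : ∀ c, c - x ∈ H → c ≠ p → c ∈ A := by
    intro c hc hcp
    by_contra hcA
    exact hcp (Finset.mem_singleton.1 (hp ▸ Finset.mem_sdiff.2 ⟨(hC c).2 hc, hcA⟩))
  -- `h` is an element of the coset `k • x + H` that is not a sum.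
  obtain ⟨h, hhC, hhS⟩ : ∃ h ∈ (k • x - x) +ᵥ C, h ∉ kSums k A :=
    Finset.exists_mem_notMem_of_card_lt_card (by rw [Finset.card_vadd_finset]; omega)
  have hh : h - k • x ∈ H := by
    obtain ⟨c, hc, rfl⟩ := Finset.mem_vadd_finset.1 hhC
    have := (hC c).1 hc
    convert this using 1
    rw [vadd_eq_add]
    abel1
  have hmiss : ∀ F ⊆ A, F.card + 1 = k → h - ∑ a ∈ F, a ∈ insert p F := by
    intro F hF hc
    rw [Finset.mem_insert]
    by_contra! hcon
    have hmem : h - ∑ a ∈ F, a - x ∈ H := by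
      have h1 : ∑ a ∈ F, a - F.card • x ∈ H := by
        rw [← Finset.sum_const, ← Finset.sum_sub_distrib]
        exact H.sum_mem fun a ha => hAH a (hF ha)
      have := H.sub_mem hh h1
      convert this using 1
      rw [← hc, succ_nsmul]
      abel1
    refine hhS ?_
    have := add_mem_kSums_succ hF (hCp _ hmem hcon.1) hcon.2
      (mem_kSums.2 ⟨F, subset_rfl, rfl, rfl⟩)
    rwa [sub_add_cancel, hc] at this
  -- Given `E`, most `e` satisfy `2e = h - ∑ E`.
  have hsol : ∀ E ⊆ A, E.card + 2 = k →
      A.card + 3 ≤ ((A \ E).filter (fun e => e + e = h - ∑ a ∈ E, a)).card + 2 * k := by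
    intro E hE hc
    have h1 : ((A \ E).filter (fun e => ¬ (e + e = h - ∑ a ∈ E, a))).card ≤ (insert p E).card := by
      refine Finset.card_le_card_of_injOn (fun e => h - ∑ a ∈ E, a - e) ?_
        (fun u _ v _ huv => sub_right_injective huv)
      intro e he
      obtain ⟨he1, he2⟩ := Finset.mem_filter.1 (Finset.mem_coe.1 he)
      obtain ⟨heA, heE⟩ := Finset.mem_sdiff.1 he1
      have := hmiss (insert e E) (Finset.insert_subset heA hE)
        (by rw [Finset.card_insert_of_notMem heE]; omega)
      rw [Finset.sum_insert heE, add_comm, ← sub_sub, Finset.mem_insert, Finset.mem_insert] at this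
      refine Finset.mem_coe.2 (Finset.mem_insert.2 ?_)
      rcases this with h3 | h3 | h3
      · exact Or.inl h3
      · exact absurd (sub_eq_iff_eq_add.1 h3).symm he2
      · exact Or.inr h3
    have h2 := Finset.card_filter_add_card_filter_not (s := A \ E)
      (fun e => e + e = h - ∑ a ∈ E, a)
    rw [Finset.card_sdiff_of_subset hE] at h2
    have h3 := Finset.card_insert_le p E
    omega
  obtain ⟨E, hE, hEc⟩ := Finset.exists_subset_card_eq (show k - 2 ≤ A.card by omega)
  set T := (A \ E).filter (fun e => e + e = h - ∑ a ∈ E, a) with hT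
  have hTc : A.card + 3 ≤ T.card + 2 * k := hsol E hE (by omega)
  obtain ⟨e₁, he₁, e₂, he₂, hne⟩ := Finset.one_lt_card.1 (show 1 < T.card by omega)
  have hTA : ∀ e ∈ T, e ∈ A ∧ e ∉ E ∧ e + e = h - ∑ a ∈ E, a := by
    intro e he
    obtain ⟨he1, he2⟩ := Finset.mem_filter.1 he
    exact ⟨(Finset.mem_sdiff.1 he1).1, (Finset.mem_sdiff.1 he1).2, he2⟩
  have hsubH : ∀ a ∈ A, ∀ b ∈ A, a - b ∈ H := by
    intro a ha b hb
    simpa using H.sub_mem (hAH a ha) (hAH b hb)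
  -- Exchanging `y ∈ E` for a solution `e` shows that `y - e` is a double.
  have hswap : ∀ y ∈ E, ∀ e ∈ T, ∃ v ∈ H, y - e = v + v := by
    intro y hy e he
    obtain ⟨heA, heE, hee⟩ := hTA e he
    have heE' : e ∉ E.erase y := fun h => heE (Finset.mem_of_mem_erase h)
    have hsub : insert e (E.erase y) ⊆ A :=
      Finset.insert_subset heA ((Finset.erase_subset _ _).trans hE)
    have h1 := hsol _ hsub (by
      rw [Finset.card_insert_of_notMem heE', Finset.card_erase_add_one hy]; omega)
    obtain ⟨f, hf⟩ := Finset.card_pos.1 (show 0 <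
      ((A \ insert e (E.erase y)).filter
        (fun f => f + f = h - ∑ a ∈ insert e (E.erase y), a)).card by omega)
    obtain ⟨hf1, hf2⟩ := Finset.mem_filter.1 hf
    refine ⟨f - e, hsubH f (Finset.mem_sdiff.1 hf1).1 e heA, ?_⟩
    rw [Finset.sum_insert heE', ← Finset.sum_erase_add _ _ hy] at *
    have h2 : f - e + (f - e) = (f + f) - (e + e) := by abel1
    rw [h2, hf2, hee]
    abel1
  obtain ⟨y₀, hy₀⟩ := Finset.card_pos.1 (show 0 < E.card by omega)
  have hfinal := two_mul_card_le_of_subset_double (X := E ∪ T) hH0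
    (hsubH e₁ (hTA e₁ he₁).1 e₂ (hTA e₂ he₂).1) (sub_ne_zero.2 hne)
    (by
      have : e₁ - e₂ + (e₁ - e₂) = (e₁ + e₁) - (e₂ + e₂) := by abel1
      rw [this, (hTA e₁ he₁).2.2, (hTA e₂ he₂).2.2, sub_self]) (y := e₁) (by
    intro z hz
    rcases Finset.mem_union.1 hz with hz | hz
    · exact hswap z hz e₁ he₁
    · obtain ⟨v, hv, hve⟩ := hswap y₀ hy₀ e₁ he₁
      obtain ⟨w, hw, hwe⟩ := hswap y₀ hy₀ z hz
      refine ⟨v - w, H.sub_mem hv hw, ?_⟩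
      have h1 : z - e₁ = (y₀ - e₁) - (y₀ - z) := by abel1
      rw [h1, hve, hwe]
      abel1)
  have hdisj : Disjoint E T := by
    rw [Finset.disjoint_left]
    exact fun z hzE hzT => (hTA z hzT).2.1 hzE
  rw [Finset.card_union_of_disjoint hdisj, hHc] at hfinal
  omega

/-- If deleting any two elements of `A` leaves a set with at least `|A| - 1` sums of `k` elements,
then the set of sums of `k + 1` elements is nearly invariant under all differences of `A`. -/
theorem card_le_card_kSums_of_forall_erase {A : Finset G} {k : ℕ} (hk : 2 ≤ k)
    (hkA : 2 * (k + 1) ≤ A.card)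
    (hW : ∀ a ∈ A, ∀ b ∈ A, a ≠ b → A.card ≤ (kSums k ((A.erase a).erase b)).card + 1) :
    A.card ≤ (kSums (k + 1) A).card ∧
      ((kSums (k + 1) A).card = A.card → ∃ H : AddSubgroup G, IsCosetOf A H) := by
  by_cases hle : (kSums (k + 1) A).card ≤ A.card
  · have key := card_eq_and_of_forall_card_filter (by omega) hle (by
      intro a ha b hb hab
      refine (hW a ha b hb hab).trans (Nat.add_le_add_right ?_ 1)
      refine Finset.card_le_card_of_injOn (fun w => a + w) ?_
        (fun u _ v _ huv => add_right_injective _ huv)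
      intro w hw
      have hsub : (A.erase a).erase b ⊆ A := (Finset.erase_subset _ _).trans (Finset.erase_subset _ _)
      refine Finset.mem_coe.2 (Finset.mem_filter.2 ⟨?_, ?_⟩)
      · exact add_mem_kSums_succ hsub ha (by simp) hw
      · change a + w - (a - b) ∈ kSums (k + 1) A
        have := add_mem_kSums_succ hsub hb (by simp) hw
        convert this using 1
        abel1)
    refine ⟨key.1.ge, fun _ => key.2.resolve_right ?_⟩
    rintro ⟨H, x, hHc, hAH⟩
    have := card_lt_card_kSums_of_card_eq_succ (by omega) hkA hHc hAH
    omega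
  · exact ⟨by omega, fun h => absurd h.le hle⟩

/-- If `A` minus two elements is contained in a coset with at most one further element, then one
of the two deleted elements lies outside that coset. -/
theorem card_kSums_add_card_kSums_le_of_coset {A B : Finset G} {k : ℕ} {H : AddSubgroup G} {g : G}
    (hB : B ⊆ A) (hAB : A.card = B.card + 2) (hH0 : Nat.card H ≠ 0)
    (hHc : Nat.card H ≤ B.card + 1) (hBH : ∀ b ∈ B, b - g ∈ H) :
    (kSums (k + 1) B).card + (kSums k B).card ≤ (kSums (k + 1) A).card := by
  obtain ⟨C, hC, hCc⟩ := exists_finset_coset H hH0 g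
  obtain ⟨a, ha, haC⟩ : ∃ a ∈ A, a ∉ C := Finset.exists_mem_notMem_of_card_lt_card (by omega)
  exact card_kSums_add_card_kSums_le hB hBH ha (fun h => haC ((hC a).2 h))

end

/-! ### Sums of at least three elements -/

section

variable {G : Type*} [AddCommGroup G] [DecidableEq G]

theorem add_add_mem_kSums_three {A : Finset G} {a b c : G} (ha : a ∈ A) (hb : b ∈ A) (hc : c ∈ A)
    (hab : a ≠ b) (hac : a ≠ c) (hbc : b ≠ c) : a + b + c ∈ kSums 3 A := by
  rw [add_assoc]
  exact add_mem_kSums_succ (k := 2) (Finset.erase_subset a A) ha (Finset.notMem_erase a A)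
    (add_mem_kSums_two (Finset.mem_erase.2 ⟨hab.symm, hb⟩) (Finset.mem_erase.2 ⟨hac.symm, hc⟩) hbc)

/-- If `A` contains two distinct cosets `{x, x + u}` and `{y, y + u}`, where `2u = 0`, then the
sums of three elements contain the translate by `x + y` of `A + {0, u}`. -/
theorem add_add_mem_kSums_three_of_shift {A : Finset G} {u x y : G} (hu0 : u ≠ 0)
    (hu : u + u = 0) (hx : x ∈ A) (hxu : x + u ∈ A) (hy : y ∈ A) (hyu : y + u ∈ A)
    (hxy : x ≠ y) (hxyu : x ≠ y + u) {c : G} (hc : c ∈ A) :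
    x + y + c ∈ kSums 3 A ∧ x + y + c + u ∈ kSums 3 A := by
  have hxu' : x ≠ x + u := by simpa using hu0
  have hyu' : y ≠ y + u := by simpa using hu0
  have hyx : x + u ≠ y := fun h => hxyu (by rw [← h, add_assoc, hu, add_zero])
  have hxuyu : x + u ≠ y + u := fun h => hxy (add_right_cancel h)
  have t1 := add_add_mem_kSums_three hx hxu hy hxu' hxy hyx
  have t2 := add_add_mem_kSums_three hx hxu hyu hxu' hxyu hxuyu
  have t3 := add_add_mem_kSums_three hx hy hyu hxy hxyu hyu'
  have t4 := add_add_mem_kSums_three hxu hy hyu hyx hxuyu hyu'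
  have e1 : x + (x + u) + y = x + y + x + u := by abel1
  have e2 : x + (x + u) + (y + u) = x + y + x + (u + u) := by abel1
  have e3 : x + y + (y + u) = x + y + y + u := by abel1
  have e4 : x + u + y + (y + u) = x + y + y + (u + u) := by abel1
  rw [hu, add_zero] at e2 e4
  rw [e1] at t1
  rw [e2] at t2
  rw [e3] at t3
  rw [e4] at t4
  by_cases h1 : c = x
  · rw [h1]; exact ⟨t2, t1⟩
  by_cases h2 : c = y
  · rw [h2]; exact ⟨t4, t3⟩
  by_cases h3 : c = x + u
  · rw [h3, ← add_assoc, add_assoc _ u u, hu, add_zero]; exact ⟨t1, t2⟩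
  by_cases h4 : c = y + u
  · rw [h4, ← add_assoc, add_assoc _ u u, hu, add_zero]; exact ⟨t3, t4⟩
  refine ⟨add_add_mem_kSums_three hx hy hc hxy (Ne.symm h1) (Ne.symm h2), ?_⟩
  have := add_add_mem_kSums_three hxu hy hc hyx (Ne.symm h3) (Ne.symm h2)
  convert this using 1
  abel1

/-- The case left open by the outside-element count: the sums of three elements contain a translate
of `A + {0, u}`, hence if there are only `|A|` of them, `A` is invariant under `u`, and then under all
of its differences. -/
theorem card_kSums_three_of_union {A B : Finset G} (hA : A.card = 6) (hBA : B ⊆ A)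
    (hBc : B.card = 4) (hB : IsUnionOfTwoCosetsOfOrderTwo B) :
    A.card ≤ (kSums 3 A).card ∧
      ((kSums 3 A).card = A.card → ∃ H : AddSubgroup G, IsCosetOf A H) := by
  obtain ⟨u, x, y, hu0, hu, rfl⟩ := hB.exists_shift
  have hx : x ∈ A := hBA (by simp)
  have hxu : x + u ∈ A := hBA (by simp)
  have hy : y ∈ A := hBA (by simp)
  have hyu : y + u ∈ A := hBA (by simp)
  have hxy : x ≠ y := by
    rintro rfl
    have := Finset.card_le_two (a := x) (b := x + u)
    simp only [Finset.insert_eq_of_mem, Finset.mem_insert, Finset.mem_singleton, true_or,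
      or_true] at hBc
    omega
  have hxyu : x ≠ y + u := by
    rintro rfl
    have h3 := Finset.card_le_three (a := y + u + u) (b := y) (c := y + u)
    rw [Finset.insert_eq_of_mem (by simp)] at hBc
    omega
  have hmem : ∀ c ∈ A, x + y + c ∈ kSums 3 A ∧ x + y + c + u ∈ kSums 3 A := fun c hc =>
    add_add_mem_kSums_three_of_shift hu0 hu hx hxu hy hyu hxy hxyu hc
  have hsub : (x + y) +ᵥ (A ∪ (u +ᵥ A)) ⊆ kSums 3 A := by
    intro s hs
    obtain ⟨c, hc, rfl⟩ := Finset.mem_vadd_finset.1 hs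
    rcases Finset.mem_union.1 hc with hc | hc
    · exact (hmem c hc).1
    · obtain ⟨d, hd, rfl⟩ := Finset.mem_vadd_finset.1 hc
      have := (hmem d hd).2
      convert this using 1
      rw [vadd_eq_add, vadd_eq_add]
      abel1
  have h1 := Finset.card_le_card hsub
  rw [Finset.card_vadd_finset] at h1
  have h2 : A.card ≤ (A ∪ (u +ᵥ A)).card := Finset.card_le_card Finset.subset_union_left
  refine ⟨h2.trans h1, fun heq => ?_⟩
  have hper : ∀ c ∈ A, c + u ∈ A := by
    intro c hc
    have h3 := Finset.eq_of_subset_of_card_le (Finset.subset_union_left (s₁ := A) (s₂ := u +ᵥ A))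
      (by omega)
    rw [h3, add_comm]
    exact Finset.mem_union_right _ (Finset.vadd_mem_vadd_finset hc)
  -- Every pair of distinct `{0, u}`-cosets in `A` translates `A` onto the set of sums.
  have htr : ∀ v ∈ A, ∀ w ∈ A, v ≠ w → v ≠ w + u → (v + w) +ᵥ A = kSums 3 A := by
    intro v hv w hw hvw hvwu
    refine Finset.eq_of_subset_of_card_le ?_ (by rw [Finset.card_vadd_finset, heq])
    intro s hs
    obtain ⟨c, hc, rfl⟩ := Finset.mem_vadd_finset.1 hs
    exact (add_add_mem_kSums_three_of_shift hu0 hu hv (hper v hv) hw (hper w hw) hvw hvwu hc).1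
  obtain ⟨H, hH, -⟩ := exists_isCosetOf_of_forall_sub_add_mem ⟨x, hx⟩ (A := A) (by
    intro a ha b hb c hc
    by_cases hab : a = b
    · simpa [hab] using hc
    by_cases hab' : a = b + u
    · rw [hab', add_sub_cancel_left, add_comm]
      exact hper c hc
    obtain ⟨w, hw, hwn⟩ : ∃ w ∈ A, w ∉ ({a, b, a + u, b + u} : Finset G) :=
      Finset.exists_mem_notMem_of_card_lt_card (Finset.card_le_four.trans_lt (by omega))
    simp only [Finset.mem_insert, Finset.mem_singleton, not_or] at hwn
    have h3 : (w + a) +ᵥ c ∈ (w + b) +ᵥ A := by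
      rw [htr w hw b hb hwn.2.1 hwn.2.2.2, ← htr w hw a ha hwn.1 hwn.2.2.1]
      exact Finset.vadd_mem_vadd_finset hc
    obtain ⟨d, hd, hde⟩ := Finset.mem_vadd_finset.1 h3
    have h4 : a - b + c = d := by
      rw [vadd_eq_add, vadd_eq_add] at hde
      have h5 : d = w + b + d - (w + b) := by abel1
      rw [h5, hde]
      abel1
    rwa [h4])
  exact ⟨H, hH⟩

theorem card_le_card_kSums_three {A : Finset G} (h6 : 6 ≤ A.card) :
    A.card ≤ (kSums 3 A).card ∧
      ((kSums 3 A).card = A.card → ∃ H : AddSubgroup G, IsCosetOf A H) := by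
  by_cases hW : ∀ a ∈ A, ∀ b ∈ A, a ≠ b → A.card ≤ (kSums 2 ((A.erase a).erase b)).card + 1
  · exact card_le_card_kSums_of_forall_erase le_rfl h6 hW
  push Not at hW
  obtain ⟨a, ha, b, hb, hab, hlt⟩ := hW
  set B := (A.erase a).erase b with hBd
  have hBA : B ⊆ A := (Finset.erase_subset _ _).trans (Finset.erase_subset _ _)
  have hBc : A.card = B.card + 2 := by
    rw [← Finset.card_erase_add_one ha,
      ← Finset.card_erase_add_one (Finset.mem_erase.2 ⟨hab.symm, hb⟩)]
  have hlow := card_le_card_kSums_two_add_one (A := B) (by omega)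
  -- For `|B| ≤ 5` the elementary bound on `kSums 3 B` is too weak; complementation inside `B`
  -- improves it.
  have hfin : ∀ (H : AddSubgroup G) (g : G), Nat.card H ≠ 0 → Nat.card H ≤ B.card + 1 →
      (∀ c ∈ B, c - g ∈ H) → A.card < (kSums 3 A).card := by
    intro H g hH0 hHc hBH
    have h1 := card_kSums_add_card_kSums_le_of_coset (k := 2) hBA hBc hH0 hHc hBH
    have h2 := card_le_card_kSums_add (k := 2) (A := B) (by omega)
    by_cases h4 : B.card = 4
    · have h3 := card_kSums_sub (k := 1) (A := B) (by omega)
      rw [h4, kSums_one] at h3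
      norm_num at *
      omega
    · by_cases h5 : B.card = 5
      · have h3 := card_kSums_sub (k := 2) (A := B) (by omega)
        rw [h5] at h3
        norm_num at *
        omega
      · norm_num at *
        omega
  have hbig : A.card < (kSums 3 A).card → A.card ≤ (kSums 3 A).card ∧
      ((kSums 3 A).card = A.card → ∃ H : AddSubgroup G, IsCosetOf A H) :=
    fun h => ⟨h.le, fun h' => absurd h'.symm h.ne⟩
  obtain ⟨g, hg⟩ := Finset.card_pos.1 (show 0 < B.card by omega)
  have hcos : (∃ H : AddSubgroup G, IsCosetOf B H) → A.card < (kSums 3 A).card := by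
    rintro ⟨H, hH⟩
    have := hH.natCard_eq
    exact hfin H g (by omega) (by omega) fun c hc => hH.sub_mem hc hg
  rcases lt_or_ge (kSums 2 B).card B.card with hlt' | hge
  · obtain ⟨H, -, hH⟩ := isTwoCoset_of_card_kSums_two_lt (by omega) hlt'
    exact hbig (hcos ⟨H, hH⟩)
  · rcases of_card_kSums_two_eq (A := B) (by omega) (by omega) with h | h | h
    · exact hbig (hcos h)
    · obtain ⟨C, ⟨H, -, hH⟩, c, hc, hBC⟩ := h
      have h1 := hH.natCard_eq
      have h2 := Finset.card_erase_add_one hc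
      rw [← hBC] at h2
      refine hbig (hfin H c (by omega) (by omega) fun d hd => hH.sub_mem ?_ hc)
      rw [hBC] at hd
      exact Finset.mem_of_mem_erase hd
    · exact card_kSums_three_of_union (by omega) hBA h.1 h.2

theorem card_le_card_kSums_of_three_le {k : ℕ} (hk : 3 ≤ k) : ∀ {A : Finset G}, 2 * k ≤ A.card →
    A.card ≤ (kSums k A).card ∧
      ((kSums k A).card = A.card → ∃ H : AddSubgroup G, IsCosetOf A H) := by
  induction k, hk using Nat.le_induction with
  | base => exact card_le_card_kSums_three
  | succ k hk ih =>
    intro A hkA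
    by_cases hW : ∀ a ∈ A, ∀ b ∈ A, a ≠ b → A.card ≤ (kSums k ((A.erase a).erase b)).card + 1
    · exact card_le_card_kSums_of_forall_erase (by omega) hkA hW
    push Not at hW
    obtain ⟨a, ha, b, hb, hab, hlt⟩ := hW
    set B := (A.erase a).erase b with hBd
    have hBA : B ⊆ A := (Finset.erase_subset _ _).trans (Finset.erase_subset _ _)
    have hBc : A.card = B.card + 2 := by
      rw [← Finset.card_erase_add_one ha,
        ← Finset.card_erase_add_one (Finset.mem_erase.2 ⟨hab.symm, hb⟩)]
    obtain ⟨h1, h2⟩ := ih (A := B) (by omega)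
    obtain ⟨H, hH⟩ := h2 (by omega)
    obtain ⟨g, hg⟩ := Finset.card_pos.1 (show 0 < B.card by omega)
    have h3 := hH.natCard_eq
    have h4 := card_kSums_add_card_kSums_le_of_coset (k := k) hBA hBc (by omega) (by omega)
      fun c hc => hH.sub_mem hc hg
    have h5 := card_le_card_kSums_add (k := k) (A := B) (by omega)
    exact ⟨by omega, fun h => by omega⟩

end

theorem theorem1 {G : Type*} [AddCommGroup G] [DecidableEq G] (A : Finset G) (k : ℕ)
    (hk : 2 ≤ k) (hkA : k + 2 ≤ A.card) :
    (A.card ≤ (kSums k A).card ↔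
      ¬ ((k = 2 ∨ k = A.card - 2) ∧ IsTwoCoset A)) ∧
    (A.card < (kSums k A).card ↔
      ¬ ((∃ H : AddSubgroup G, IsCosetOf A H) ∨
        ((k = 2 ∨ k = A.card - 2) ∧
          (IsAlmostTwoCoset A ∨ (A.card = 4 ∧ IsUnionOfTwoCosetsOfOrderTwo A))))) := by
  have hne : A.Nonempty := Finset.card_pos.1 (by omega)
  by_cases hk2 : k = 2 ∨ k = A.card - 2
  · have hS : (kSums k A).card = (kSums 2 A).card := by
      rcases hk2 with rfl | rfl
      · rfl
      · exact card_kSums_sub (by omega)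
    simp only [hS, hk2, true_and]
    refine ⟨⟨fun h hT => ?_, fun h => ?_⟩, ⟨fun h hex => ?_, fun h => ?_⟩⟩
    · exact absurd (hT.card_kSums_two_lt hne) h.not_gt
    · by_contra hlt
      exact h (isTwoCoset_of_card_kSums_two_lt (by omega) (not_le.1 hlt))
    · rcases hex with ⟨H, hH⟩ | hA | ⟨h4, hU⟩
      · exact absurd (hH.card_kSums_le (k := 2) hne) h.not_ge
      · exact absurd hA.card_kSums_two_le h.not_ge
      · exact absurd hU.card_kSums_two_le (by omega)
    · by_contra hle
      rcases (not_lt.1 hle).eq_or_lt with heq | hlt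
      · exact h (of_card_kSums_two_eq (by omega) heq)
      · obtain ⟨H, -, hH⟩ := isTwoCoset_of_card_kSums_two_lt (by omega) hlt
        exact h (Or.inl ⟨H, hH⟩)
  · have key : A.card ≤ (kSums k A).card ∧
        ((kSums k A).card = A.card → ∃ H : AddSubgroup G, IsCosetOf A H) := by
      -- Complementation reduces to `k ≤ |A| / 2`.
      rcases le_total (2 * k) A.card with h | h
      · exact card_le_card_kSums_of_three_le (by omega) h
      · rw [← card_kSums_sub (show k ≤ A.card by omega)]
        exact card_le_card_kSums_of_three_le (by omega) (by omega)
    simp only [hk2, false_and, not_false_eq_true, iff_true, or_false]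
    refine ⟨key.1, fun h hex => ?_, fun h => ?_⟩
    · obtain ⟨H, hH⟩ := hex
      exact absurd (hH.card_kSums_le (k := k) hne) h.not_ge
    · exact lt_of_le_of_ne key.1 fun heq => h (key.2 heq.symm)
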